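/- Let $\mathbb K\in\{\mathbb R,\mathbb C\}$, let $p\in(0,\infty)$, let $\emptyset\neq\Gamma\subset(0,\infty]\setminus\{p\}$, and let $(\Omega,\mathcal M,\mu)$ be an arbitrary measure space. For a measurable $X\subset\Omega$ let $L_p(X)$ be the $\mathbb K$-vector space of ($\mu$-a.e. classes of) measurable $f:X\to\mathbb K$ with $\|f\|_p=\left(\int_X|f|^p\,d\mu\right)^{1/p}<\infty$, with the topology given by $\|\cdot\|_p$ (for $0<p<1$, by the metric $\|f-g\|_p^p$); $L_\infty(X)$ consists of the essentially bounded functions. A subset $A$ of a vector space $E$ is lineable if there is an infinite-dimensional subspace $F$ of $E$ with $F\setminus\{0\}\subset A$, and $\alpha$-lineable if there is a subspace $F$ with $\dim F=\alpha$ and $F\setminus\{0\}\subset A$. For cardinals $\alpha$ and $\beta$, a subset $A$ of a topological vector space $E$ is $(\alpha,\beta)$-spaceable if $\alpha<\beta$, $A$ is $\alpha$-lineable, and for every subspace $F_\alpha\subset A\cup\{0\}$ with $\dim F_\alpha=\alpha$ there is a closed subspace $F_\beta$ of $E$ with $\dim F_\beta=\beta$ and $F_\alpha\subset F_\beta\subset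 A\cup\{0\}$. Suppose there is a sequence $(\Omega_i)_{i\in\mathbb N}$ of pairwise disjoint measurable sets with $\Omega=\bigcup_{i\in\mathbb N}\Omega_i$ such that, for every $i\in\mathbb N$, the set $$L_p(\Omega_i)\setminus\operatorname{span}\Big(\bigcup_{q\in\Gamma}L_q(\Omega_i)\cap L_p(\Omega_i)\Big)$$ is lineable. Then, for every cardinal $\alpha$, the set $L_p(\Omega)\setminus\bigcup_{q\in\Gamma}L_q(\Omega)$ is $(\alpha,\mathfrak c)$-spaceable in $L_p(\Omega)$ if and only if $\alpha<\aleph_0$, where $\mathfrak c$ is the cardinality of $\mathbb R$. (This includes the non-locally convex range $0<p<1$.) -/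

import Mathlib

open MeasureTheory
open scoped ENNReal Cardinal Topology

namespace Lineability

universe u v

variable (𝕜 : Type u) {E : Type v} [RCLike 𝕜] [AddCommGroup E] [Module 𝕜 E]

/-- `A ⊆ E` is lineable: there is an infinite dimensional subspace `F` with `F \ {0} ⊆ A`. -/
def IsLineable (A : Set E) : Prop :=
  ∃ F : Submodule 𝕜 E, ¬ FiniteDimensional 𝕜 F ∧ (F : Set E) \ {0} ⊆ A

/-- `A ⊆ E` is `β`-lineable: there is a `β`-dimensional subspace `F` with `F \ {0} ⊆ A`. -/
def IsCardLineable (β : Cardinal.{v}) (A : Set E) : Prop :=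
  ∃ F : Submodule 𝕜 E, Module.rank 𝕜 F = β ∧ (F : Set E) \ {0} ⊆ A

/-- `A ⊆ E` is `(α, β)`-spaceable for the topology `τ` of `E`: `α < β`, `A` is `α`-lineable, and
every `α`-dimensional subspace contained in `A ∪ {0}` is contained in a closed `β`-dimensional
subspace which is itself contained in `A ∪ {0}`. -/
def IsSpaceable (τ : TopologicalSpace E) (α β : Cardinal.{v}) (A : Set E) : Prop :=
  α < β ∧ IsCardLineable 𝕜 α A ∧
    ∀ F : Submodule 𝕜 E, Module.rank 𝕜 F = α → (F : Set E) ⊆ A ∪ {0} →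
      ∃ G : Submodule 𝕜 E, Module.rank 𝕜 G = β ∧ IsClosed[τ] (G : Set E) ∧
        F ≤ G ∧ (G : Set E) ⊆ A ∪ {0}

end Lineability

namespace LebesgueSpace

variable (𝕜 : Type*) [RCLike 𝕜] {Ω : Type*} [MeasurableSpace Ω] (μ : Measure Ω)

/-- The topology of `L_p(Ω)` given by `‖·‖_p`, for every exponent `p` (Mathlib's instance covers
only `1 ≤ p`): a set is open iff around each of its points it contains a `‖·‖_p`-ball. For
`0 < p < 1` this is the topology of the metric `‖f - g‖_p ^ p`. -/
@[reducible]
def lpTopology (p : ℝ≥0∞) : TopologicalSpace (Lp 𝕜 p μ) where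
  IsOpen U := ∀ f ∈ U, ∃ ε : ℝ, 0 < ε ∧ ∀ g : Lp 𝕜 p μ, ‖g - f‖ < ε → g ∈ U
  isOpen_univ := fun _ _ => ⟨1, one_pos, fun _ _ => trivial⟩
  isOpen_inter := by
    rintro U V hU hV f ⟨hfU, hfV⟩
    obtain ⟨a, ha, hau⟩ := hU f hfU
    obtain ⟨b, hb, hbv⟩ := hV f hfV
    exact ⟨min a b, lt_min ha hb, fun g hg =>
      ⟨hau g (hg.trans_le (min_le_left a b)), hbv g (hg.trans_le (min_le_right a b))⟩⟩
  isOpen_sUnion := by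
    rintro S hS f ⟨U, hU, hfU⟩
    obtain ⟨a, ha, hau⟩ := hS U hU f hfU
    exact ⟨a, ha, fun g hg => ⟨U, hU, hau g hg⟩⟩

/-- The set `⋃_{q ∈ Γ} L_q(Ω) ∩ L_p(Ω)`, as a subset of `L_p(Ω)`. -/
def unionLq (p : ℝ≥0∞) (Γ : Set ℝ≥0∞) : Set (Lp 𝕜 p μ) :=
  ⋃ q ∈ Γ, {f : Lp 𝕜 p μ | MemLp f q μ}

end LebesgueSpace

/-! Write A for the complement of the union. If α is finite and F ⊆ A ∪ {0} has dimension α,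
lineability makes the span S_i of the bad functions on Ω_i of infinite codimension, so some g_i
avoids S_i + F|Ω_i. Glue rescaled g_i to one U, and let H consist of the L_p functions that are a
multiple of U on each Ω_i. H is closed of dimension 𝔠, so H + F is too. If h + f lies in some L_q,
restriction to Ω_i forces h = 0 there, hence h + f = f ∈ F (`exists_isClosed_extension`). If α is
infinite, perturb F to {x + φ(x)u}, with u ≠ 0 in every L_q and φ a discontinuous functional on F.
This space has the same dimension and stays in A ∪ {0}, but u is in its closure
(`rank_lt_aleph0_of_isSpaceable`). -/

namespace LebesgueSpace

/-! ### The quasi-norm topology as a vector space topology -/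

section Topology

variable {𝕜 : Type*} [RCLike 𝕜] {Ω : Type*} [MeasurableSpace Ω] {μ : Measure Ω} {p : ℝ≥0∞}

theorem lp_norm_nonneg (f : Lp 𝕜 p μ) : 0 ≤ ‖f‖ :=
  ENNReal.toReal_nonneg

theorem lp_norm_smul (c : 𝕜) (f : Lp 𝕜 p μ) : ‖c • f‖ = ‖c‖ * ‖f‖ := by
  rw [Lp.norm_def, Lp.norm_def, eLpNorm_congr_ae (Lp.coeFn_smul c f), eLpNorm_const_smul,
    ENNReal.toReal_mul, toReal_enorm]

theorem lp_norm_add_le (f g : Lp 𝕜 p μ) :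
    ‖f + g‖ ≤ (ENNReal.LpAddConst p).toReal * (‖f‖ + ‖g‖) := by
  have hf := Lp.eLpNorm_ne_top f
  have hg := Lp.eLpNorm_ne_top g
  have hc := (ENNReal.LpAddConst_lt_top p).ne
  rw [Lp.norm_def, Lp.norm_def, Lp.norm_def, eLpNorm_congr_ae (Lp.coeFn_add f g),
    ← ENNReal.toReal_add hf hg, ← ENNReal.toReal_mul]
  exact ENNReal.toReal_mono (ENNReal.mul_ne_top hc (ENNReal.add_ne_top.2 ⟨hf, hg⟩))
    (eLpNorm_add_le' (Lp.aestronglyMeasurable f) (Lp.aestronglyMeasurable g) p)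

variable (𝕜 μ p) in
/-- The balls of the quasi-norm `‖·‖_p` around the origin form a basis of neighbourhoods of a
vector space topology. -/
@[reducible]
def lpBallBasis : ModuleFilterBasis 𝕜 (Lp 𝕜 p μ) where
  sets := {U | ∃ ε : ℝ, 0 < ε ∧ U = {f | ‖f‖ < ε}}
  nonempty := ⟨_, 1, one_pos, rfl⟩
  inter_sets := by
    rintro _ _ ⟨a, ha, rfl⟩ ⟨b, hb, rfl⟩
    exact ⟨_, ⟨min a b, lt_min ha hb, rfl⟩, fun f hf => by simpa using hf⟩
  zero' := by
    rintro _ ⟨a, ha, rfl⟩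
    simpa using ha
  add' := by
    rintro _ ⟨a, ha, rfl⟩
    have hC : 0 ≤ (ENNReal.LpAddConst p).toReal := ENNReal.toReal_nonneg
    -- The radius absorbs the quasi-triangle constant C, since C / (C + 1) < 1.
    refine ⟨_, ⟨a / (2 * ((ENNReal.LpAddConst p).toReal + 1)), by positivity, rfl⟩, ?_⟩
    rintro _ ⟨f, hf, g, hg, rfl⟩
    simp only [Set.mem_ofPred_eq] at hf hg ⊢
    rw [lt_div_iff₀ (by positivity)] at hf hg
    have hf0 := lp_norm_nonneg f
    have hg0 := lp_norm_nonneg g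
    refine (lp_norm_add_le f g).trans_lt ?_
    nlinarith
  neg' := by
    rintro _ ⟨a, ha, rfl⟩
    exact ⟨_, ⟨a, ha, rfl⟩, fun f hf => by simpa using hf⟩
  conj' := by
    rintro f₀ _ ⟨a, ha, rfl⟩
    exact ⟨_, ⟨a, ha, rfl⟩, fun f hf => by simpa using hf⟩
  smul' := by
    rintro _ ⟨a, ha, rfl⟩
    refine ⟨Metric.ball 0 1, Metric.ball_mem_nhds _ one_pos, _, ⟨a, ha, rfl⟩, ?_⟩
    rintro _ ⟨c, hc, f, hf, rfl⟩
    simp only [Set.mem_ofPred_eq, mem_ball_zero_iff] at hf hc ⊢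
    simp only [lp_norm_smul]
    have hf0 := lp_norm_nonneg f
    nlinarith
  smul_left' := by
    rintro c _ ⟨a, ha, rfl⟩
    refine ⟨_, ⟨a / (‖c‖ + 1), by positivity, rfl⟩, fun f hf => ?_⟩
    simp only [Set.mem_ofPred_eq, Set.mem_preimage, lp_norm_smul] at hf ⊢
    rw [lt_div_iff₀ (by positivity)] at hf
    have hf0 := lp_norm_nonneg f
    nlinarith
  smul_right' := by
    rintro f _ ⟨a, ha, rfl⟩
    have hf0 := lp_norm_nonneg f
    filter_upwards [Metric.ball_mem_nhds (0 : 𝕜) (show 0 < a / (‖f‖ + 1) by positivity)] with c hc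
    simp only [mem_ball_zero_iff, lp_norm_smul] at hc ⊢
    rw [lt_div_iff₀ (by positivity)] at hc
    have hc0 := norm_nonneg c
    nlinarith

variable (𝕜 μ p) in
theorem lpTopology_eq : lpTopology 𝕜 μ p = (lpBallBasis 𝕜 μ p).topology := by
  refine TopologicalSpace.ext_iff.2 fun U => ?_
  refine Iff.trans ?_ (@isOpen_iff_mem_nhds _ (lpBallBasis 𝕜 μ p).topology U).symm
  refine forall₂_congr fun f _ => ?_
  rw [((lpBallBasis 𝕜 μ p).toAddGroupFilterBasis.nhds_hasBasis f).mem_iff]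
  constructor
  · rintro ⟨ε, hε, h⟩
    refine ⟨_, ⟨ε, hε, rfl⟩, ?_⟩
    rintro _ ⟨g, hg, rfl⟩
    exact h _ (by simpa using hg)
  · rintro ⟨_, ⟨ε, hε, rfl⟩, h⟩
    exact ⟨ε, hε, fun g hg => h ⟨g - f, hg, by simp⟩⟩

attribute [local instance] lpTopology

theorem isTopologicalAddGroup_lpTopology : IsTopologicalAddGroup (Lp 𝕜 p μ) := by
  rw [lpTopology_eq 𝕜 μ p]
  exact (lpBallBasis 𝕜 μ p).toAddGroupFilterBasis.isTopologicalAddGroup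

theorem continuousSMul_lpTopology : ContinuousSMul 𝕜 (Lp 𝕜 p μ) := by
  rw [lpTopology_eq 𝕜 μ p]
  exact (lpBallBasis 𝕜 μ p).continuousSMul

theorem t1Space_lpTopology (hp : 0 < p) : T1Space (Lp 𝕜 p μ) := by
  refine ⟨fun f => ⟨fun g hg => ⟨‖g - f‖, ?_, fun h hh => ?_⟩⟩⟩
  · refine (lp_norm_nonneg _).lt_of_ne' fun h => hg ?_
    rw [Lp.norm_eq_zero_iff hp, sub_eq_zero] at h
    exact h
  · rintro rfl
    rw [← Lp.norm_neg, neg_sub] at hh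
    exact lt_irrefl _ hh

theorem isClosed_of_finiteDimensional (hp : 0 < p) (F : Submodule 𝕜 (Lp 𝕜 p μ))
    [FiniteDimensional 𝕜 F] : IsClosed (F : Set (Lp 𝕜 p μ)) := by
  have := isTopologicalAddGroup_lpTopology (𝕜 := 𝕜) (μ := μ) (p := p)
  have := continuousSMul_lpTopology (𝕜 := 𝕜) (μ := μ) (p := p)
  have := t1Space_lpTopology (𝕜 := 𝕜) (μ := μ) hp
  exact F.closed_of_finiteDimensional

theorem isClosed_sup_of_finiteDimensional (H F : Submodule 𝕜 (Lp 𝕜 p μ))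
    [FiniteDimensional 𝕜 F] (hH : IsClosed (H : Set (Lp 𝕜 p μ))) :
    IsClosed ((H ⊔ F : Submodule 𝕜 (Lp 𝕜 p μ)) : Set (Lp 𝕜 p μ)) := by
  have := isTopologicalAddGroup_lpTopology (𝕜 := 𝕜) (μ := μ) (p := p)
  have := continuousSMul_lpTopology (𝕜 := 𝕜) (μ := μ) (p := p)
  exact Submodule.isClosed_sup_finiteDimensional H F hH

variable (𝕜 μ p) in
/-- Restriction of functions to a subset, as a linear map of `L_p` spaces. -/
noncomputable def restrictL (s : Set Ω) : Lp 𝕜 p μ →ₗ[𝕜] Lp 𝕜 p (μ.restrict s) where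
  toFun f := ((Lp.memLp f).restrict s).toLp f
  map_add' f g := by
    rw [← MemLp.toLp_add]
    exact MemLp.toLp_congr _ _ (ae_restrict_of_ae (Lp.coeFn_add f g))
  map_smul' c f := by
    rw [RingHom.id_apply, ← MemLp.toLp_const_smul]
    exact MemLp.toLp_congr _ _ (ae_restrict_of_ae (Lp.coeFn_smul c f))

theorem coeFn_restrictL (s : Set Ω) (f : Lp 𝕜 p μ) :
    restrictL 𝕜 μ p s f =ᵐ[μ.restrict s] f :=
  MemLp.coeFn_toLp ((Lp.memLp f).restrict s)

theorem norm_restrictL_le (s : Set Ω) (f : Lp 𝕜 p μ) : ‖restrictL 𝕜 μ p s f‖ ≤ ‖f‖ := by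
  rw [Lp.norm_def, Lp.norm_def, eLpNorm_congr_ae (coeFn_restrictL s f)]
  exact ENNReal.toReal_mono (Lp.eLpNorm_ne_top f) (eLpNorm_mono_measure _ Measure.restrict_le_self)

theorem continuous_restrictL (s : Set Ω) : Continuous (restrictL 𝕜 μ p s) := by
  refine ⟨fun U hU f hf => ?_⟩
  obtain ⟨ε, hε, h⟩ := hU _ hf
  refine ⟨ε, hε, fun g hg => h _ ?_⟩
  rw [← map_sub]
  exact (norm_restrictL_le s _).trans_lt hg

end Topology

/-! ### Necessity: infinite α is impossible -/

section Necessity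

variable {𝕜 : Type*} [RCLike 𝕜] {Ω : Type*} [MeasurableSpace Ω] {μ : Measure Ω} {p : ℝ≥0∞}

/-- Some superlevel set of |f| is non-null, and it has finite measure by Chebyshev; its indicator
serves. -/
theorem exists_ne_zero_forall_memLp (hp0 : p ≠ 0) (hp : p ≠ ∞) {f : Lp 𝕜 p μ} (hf : f ≠ 0) :
    ∃ h : Lp 𝕜 p μ, h ≠ 0 ∧ ∀ q : ℝ≥0∞, MemLp h q μ := by
  obtain ⟨n, hn⟩ : ∃ n : ℕ, μ {x | ((n : ℝ≥0∞) + 1)⁻¹ ≤ ‖f x‖ₑ} ≠ 0 := by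
    by_contra! H
    refine hf ((Lp.eq_zero_iff_ae_eq_zero).2 ?_)
    have : ∀ᵐ x ∂μ, ∀ n : ℕ, ¬ ((n : ℝ≥0∞) + 1)⁻¹ ≤ ‖f x‖ₑ :=
      ae_all_iff.2 fun n => by simpa [ae_iff] using H n
    filter_upwards [this] with x hx
    by_contra hne
    obtain ⟨n, hn⟩ := ENNReal.exists_inv_nat_lt (enorm_ne_zero.2 hne)
    exact hx n ((ENNReal.inv_le_inv.2 le_self_add).trans hn.le)
  set s := {x | ((n : ℝ≥0∞) + 1)⁻¹ ≤ ‖f x‖ₑ} with hs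
  have hsm : MeasurableSet s :=
    measurableSet_le measurable_const (Lp.stronglyMeasurable f).enorm
  have hfin : μ s ≠ ∞ :=
    ((Lp.memLp f).meas_ge_lt_top' hp0 hp (by simp : ((n : ℝ≥0∞) + 1)⁻¹ ≠ 0)).ne
  have hmem : ∀ q : ℝ≥0∞, MemLp (s.indicator fun _ => (1 : 𝕜)) q μ := fun q =>
    memLp_indicator_const q hsm 1 (Or.inr hfin)
  refine ⟨(hmem p).toLp _, fun h0 => hn ?_, fun q => (hmem q).ae_eq (hmem p).coeFn_toLp.symm⟩
  have h1 := (Lp.eq_zero_iff_ae_eq_zero).1 h0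
  have h2 : ∀ᵐ x ∂μ, x ∉ s := by
    filter_upwards [h1, (hmem p).coeFn_toLp] with x hx1 hx2 hxs
    rw [hx1, Set.indicator_of_mem hxs] at hx2
    simp at hx2
  simpa [ae_iff] using h2

theorem exists_functional_not_bounded (F : Submodule 𝕜 (Lp 𝕜 p μ))
    (hF : ℵ₀ ≤ Module.rank 𝕜 F) :
    ∃ φ : F →ₗ[𝕜] 𝕜, ∀ ε : ℝ, 0 < ε → ∃ x : F, φ x = 1 ∧ ‖(x : Lp 𝕜 p μ)‖ < ε := by
  classical
  let b := Module.Basis.ofVectorSpace 𝕜 F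
  have hinf : Infinite (Module.Basis.ofVectorSpaceIndex 𝕜 F) := by
    rw [Cardinal.infinite_iff, b.mk_eq_rank'']
    exact hF
  let e := Infinite.natEmbedding (Module.Basis.ofVectorSpaceIndex 𝕜 F)
  -- With φ(b_n) = k_n, the vector b_n / k_n has value 1 and norm below 1 / (n + 1).
  let k : ℕ → ℝ := fun n => (n + 1) * (‖(b (e n) : Lp 𝕜 p μ)‖ + 1)
  have hk : ∀ n, 0 < k n := fun n => by
    have := lp_norm_nonneg (b (e n) : Lp 𝕜 p μ)
    positivity
  let φ : F →ₗ[𝕜] 𝕜 := b.constr 𝕜 (Function.extend e (fun n => (k n : 𝕜)) 0)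
  have hφ : ∀ n, φ (b (e n)) = k n := fun n => by
    simp only [φ, b.constr_basis, e.injective.extend_apply]
  refine ⟨φ, fun ε hε => ?_⟩
  obtain ⟨n, hn⟩ := exists_nat_one_div_lt hε
  have hk0 : (k n : 𝕜) ≠ 0 := by exact_mod_cast (hk n).ne'
  refine ⟨(k n : 𝕜)⁻¹ • b (e n), by rw [map_smul, hφ, smul_eq_mul, inv_mul_cancel₀ hk0], ?_⟩
  refine lt_of_le_of_lt ?_ hn
  have h0 := lp_norm_nonneg (b (e n) : Lp 𝕜 p μ)
  rw [Submodule.coe_smul, lp_norm_smul, norm_inv, RCLike.norm_ofReal, abs_of_pos (hk n),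
    inv_mul_le_iff₀ (hk n)]
  simp only [k]
  have : (0 : ℝ) < n + 1 := by positivity
  field_simp
  linarith

theorem mem_of_isClosed_lpTopology {G : Set (Lp 𝕜 p μ)} (hG : IsClosed[lpTopology 𝕜 μ p] G)
    {h : Lp 𝕜 p μ} (H : ∀ ε : ℝ, 0 < ε → ∃ g ∈ G, ‖g - h‖ < ε) : h ∈ G := by
  by_contra hh
  obtain ⟨ε, hε, hb⟩ := (@isOpen_compl_iff _ G (lpTopology 𝕜 μ p)).2 hG h hh
  obtain ⟨g, hg, hgh⟩ := H ε hε
  exact hb g hgh hg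

theorem rank_lt_aleph0_of_isSpaceable (hp0 : p ≠ 0) (hp : p ≠ ∞) {Γ : Set ℝ≥0∞}
    (hΓ : Γ.Nonempty) {α β : Cardinal}
    (h : Lineability.IsSpaceable 𝕜 (lpTopology 𝕜 μ p) α β (unionLq 𝕜 μ p Γ)ᶜ) : α < ℵ₀ := by
  by_contra! hα
  obtain ⟨-, ⟨F, rfl, hFA⟩, hsp⟩ := h
  obtain ⟨f, hf⟩ : ∃ f : F, f ≠ 0 := by
    have : Nontrivial F := rank_pos_iff_nontrivial.1 (Cardinal.aleph0_pos.trans_le hα)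
    exact exists_ne 0
  obtain ⟨u, hu0, hu⟩ := exists_ne_zero_forall_memLp hp0 hp (f := (f : Lp 𝕜 p μ)) (by simpa using hf)
  obtain ⟨φ, hφ⟩ := exists_functional_not_bounded F hα
  let T : F →ₗ[𝕜] Lp 𝕜 p μ := F.subtype + φ.smulRight u
  have hT : ∀ x, T x = x + φ x • u := fun x => rfl
  have hTmem : ∀ x, T x ∈ unionLq 𝕜 μ p Γ → x = 0 := by
    intro x hx
    by_contra hx0
    refine hFA ⟨x.2, by simpa using hx0⟩ ?_
    simp only [unionLq, Set.mem_iUnion] at hx ⊢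
    obtain ⟨q, hq, hxq⟩ := hx
    refine ⟨q, hq, ?_⟩
    have hxq : MemLp (T x) q μ := hxq
    have hx' : (x : Lp 𝕜 p μ) = T x - φ x • u := by rw [hT]; abel
    show MemLp (x : Lp 𝕜 p μ) q μ
    refine (hxq.sub ((hu q).const_smul (φ x))).ae_eq ?_
    rw [hx']
    filter_upwards [Lp.coeFn_sub (T x) (φ x • u), Lp.coeFn_smul (φ x) u] with y h1 h2
    rw [h1, Pi.sub_apply, Pi.sub_apply, h2]
  obtain ⟨q, hq⟩ := hΓ
  have h0 : (0 : Lp 𝕜 p μ) ∈ unionLq 𝕜 μ p Γ :=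
    Set.mem_iUnion₂.2 ⟨q, hq, (MemLp.zero' : MemLp (fun _ => (0 : 𝕜)) q μ).ae_eq
      (Lp.coeFn_zero 𝕜 p μ).symm⟩
  have hinj : Function.Injective T := by
    rw [← LinearMap.ker_eq_bot, LinearMap.ker_eq_bot']
    exact fun x hx => hTmem x (hx ▸ h0)
  obtain ⟨G, -, hGc, hFG, hGA⟩ := hsp (LinearMap.range T)
    (LinearEquiv.ofInjective T hinj).rank_eq.symm (by
      rintro _ ⟨x, rfl⟩
      by_cases hx : x = 0
      · right; simp [hx]
      · exact Or.inl fun h => hx (hTmem x h))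
  have huG : u ∈ (G : Set (Lp 𝕜 p μ)) := by
    refine mem_of_isClosed_lpTopology hGc fun ε hε => ?_
    obtain ⟨x, hx1, hxε⟩ := hφ ε hε
    exact ⟨T x, hFG ⟨x, rfl⟩, by rw [hT, hx1, one_smul, add_sub_cancel_right]; exact hxε⟩
  rcases hGA huG with h | h
  · exact h (Set.mem_iUnion₂.2 ⟨q, hq, hu q⟩)
  · exact hu0 h

end Necessity

end LebesgueSpace

/-- An infinite-dimensional W meeting S only in 0 embeds in E ⧸ S, which would be finite-dimensional
if S + F were everything. -/
theorem Lineability.IsLineable.exists_notMem_sup {𝕜 E : Type*} [RCLike 𝕜] [AddCommGroup E]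
    [Module 𝕜 E] {S : Submodule 𝕜 E} (hS : Lineability.IsLineable 𝕜 ((S : Set E)ᶜ))
    (F : Submodule 𝕜 E) [FiniteDimensional 𝕜 F] : ∃ g, g ∉ S ⊔ F := by
  by_contra! H
  obtain ⟨W, hW, hWS⟩ := hS
  refine hW ?_
  have hfin : FiniteDimensional 𝕜 (E ⧸ S) := by
    refine Module.Finite.of_surjective (S.mkQ ∘ₗ F.subtype) fun x => ?_
    obtain ⟨x, rfl⟩ := S.mkQ_surjective x
    obtain ⟨s, hs, f, hf, rfl⟩ := Submodule.mem_sup.1 (H x)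
    refine ⟨⟨f, hf⟩, ?_⟩
    simpa using hs
  refine Module.Finite.of_injective (S.mkQ ∘ₗ W.subtype) ?_
  rw [← LinearMap.ker_eq_bot, LinearMap.ker_eq_bot']
  intro w hw
  by_contra hw0
  exact hWS ⟨w.2, by simpa using hw0⟩ (by simpa using hw)

theorem exists_measurable_index {Ω : Type*} [MeasurableSpace Ω] {Ωs : ℕ → Set Ω}
    (hmeas : ∀ i, MeasurableSet (Ωs i)) (hdisj : ∀ i j, i ≠ j → Ωs i ∩ Ωs j = ∅)
    (hunion : ⋃ i, Ωs i = Set.univ) :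
    ∃ κ : Ω → ℕ, Measurable κ ∧ ∀ i, ∀ x ∈ Ωs i, κ x = i := by
  have hex : ∀ x, ∃ i, x ∈ Ωs i := fun x => Set.mem_iUnion.1 (hunion ▸ Set.mem_univ x)
  choose κ hκ using hex
  have huniq : ∀ i, ∀ x ∈ Ωs i, κ x = i := fun i x hx => by
    by_contra hne
    have : x ∈ Ωs (κ x) ∩ Ωs i := ⟨hκ x, hx⟩
    rw [hdisj _ _ hne] at this
    exact this
  refine ⟨κ, measurable_to_countable' fun i => ?_, huniq⟩
  convert hmeas i using 1
  ext x
  exact ⟨fun h => by have := hκ x; rwa [show κ x = i from h] at this, huniq i x⟩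

namespace RCLike

theorem mk_pi_nat_le_continuum (𝕜 : Type*) [RCLike 𝕜] : #(ℕ → 𝕜) ≤ 𝔠 := by
  have h : #𝕜 ≤ 𝔠 := by
    have hinj : Function.Injective fun z : 𝕜 => (re z, im z) := fun z w h =>
      RCLike.ext (congrArg Prod.fst h) (congrArg Prod.snd h)
    simpa [Cardinal.mk_real] using Cardinal.lift_mk_le_lift_mk_of_injective hinj
  calc #(ℕ → 𝕜) = #𝕜 ^ ℵ₀ := by simp
    _ ≤ 𝔠 ^ ℵ₀ := Cardinal.power_le_power_right h
    _ = 𝔠 := Cardinal.continuum_power_aleph0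

end RCLike

namespace LebesgueSpace

/-! ### Sufficiency: gluing and the closed extension -/

section Sufficiency

variable {𝕜 : Type*} [RCLike 𝕜] {Ω : Type*} [MeasurableSpace Ω] {μ : Measure Ω} {p : ℝ≥0∞}
  {Ωs : ℕ → Set Ω}

theorem exists_small_smul (g : Lp 𝕜 p μ) {δ : ℝ≥0∞} (hδ : δ ≠ 0) :
    ∃ c : 𝕜, c ≠ 0 ∧ eLpNorm (c • ⇑g) p μ ≤ δ := by
  obtain ⟨r, hr0, hr⟩ : ∃ r : ℝ, 0 < r ∧ ENNReal.ofReal r ≤ δ := by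
    rcases eq_or_ne δ ∞ with rfl | hδt
    · exact ⟨1, one_pos, le_top⟩
    · exact ⟨δ.toReal, ENNReal.toReal_pos hδ hδt, (ENNReal.ofReal_toReal hδt).le⟩
  have hg := lp_norm_nonneg g
  have hc : 0 < r / (‖g‖ + 1) := by positivity
  refine ⟨((r / (‖g‖ + 1) : ℝ) : 𝕜), by exact_mod_cast hc.ne', le_trans ?_ hr⟩
  rw [eLpNorm_const_smul, ← ENNReal.ofReal_toReal (Lp.eLpNorm_ne_top g), ← Lp.norm_def,
    ← ofReal_norm, RCLike.norm_ofReal, abs_of_pos hc, ← ENNReal.ofReal_mul hc.le]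
  refine ENNReal.ofReal_le_ofReal ?_
  rw [div_mul_eq_mul_div, div_le_iff₀ (by positivity)]
  nlinarith

theorem eq_zero_of_restrictL (hunion : ⋃ i, Ωs i = Set.univ) {f : Lp 𝕜 p μ}
    (h : ∀ i, restrictL 𝕜 μ p (Ωs i) f = 0) : f = 0 := by
  rw [Lp.eq_zero_iff_ae_eq_zero]
  have : ∀ᵐ x ∂μ.restrict (⋃ i, Ωs i), f x = 0 := by
    rw [ae_restrict_iUnion_iff]
    intro i
    filter_upwards [coeFn_restrictL (Ωs i) f, (Lp.eq_zero_iff_ae_eq_zero).1 (h i)] with x h1 h2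
    rw [← h1, h2, Pi.zero_apply]
  rwa [hunion, Measure.restrict_univ] at this

theorem exists_glue (hp0 : p ≠ 0) (hp : p ≠ ∞) (hmeas : ∀ i, MeasurableSet (Ωs i))
    (hdisj : ∀ i j, i ≠ j → Ωs i ∩ Ωs j = ∅) (hunion : ⋃ i, Ωs i = Set.univ)
    (g : ∀ i, Lp 𝕜 p (μ.restrict (Ωs i))) :
    ∃ (U : Lp 𝕜 p μ) (c : ℕ → 𝕜), ∀ i, c i ≠ 0 ∧ restrictL 𝕜 μ p (Ωs i) U = c i • g i := by
  obtain ⟨κ, hκ, hκi⟩ := exists_measurable_index hmeas hdisj hunion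
  have hp' : 0 < p.toReal := ENNReal.toReal_pos hp0 hp
  -- With these bounds on the norms of the pieces, the integrals of their p-th powers are dominated
  -- by a geometric series.
  have hδ : ∀ i : ℕ, ((2⁻¹ : ℝ≥0∞) ^ i) ^ (1 / p.toReal) ≠ 0 := fun i => by
    have h2 : (2⁻¹ : ℝ≥0∞) ^ i ≠ 0 := pow_ne_zero _ (by simp)
    have h3 : (2⁻¹ : ℝ≥0∞) ^ i ≠ ∞ := ENNReal.pow_ne_top (by simp)
    exact (ENNReal.rpow_pos (pos_iff_ne_zero.2 h2) h3).ne'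
  choose c hc0 hc using fun i => exists_small_smul (g i) (hδ i)
  let u : Ω → 𝕜 := fun x => c (κ x) * g (κ x) x
  have hum : Measurable u := by
    have : Measurable fun y : ℕ × Ω => c y.1 * g y.1 y.2 :=
      measurable_from_prod_countable_right fun i =>
        (Lp.stronglyMeasurable (g i)).measurable.const_mul (c i)
    exact this.comp (hκ.prodMk measurable_id)
  have hres : ∀ i, u =ᵐ[μ.restrict (Ωs i)] c i • ⇑(g i) := fun i =>
    (ae_restrict_mem (hmeas i)).mono fun x hx => by
      obtain rfl := hκi i x hx
      rfl
  have hu : MemLp u p μ := by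
    refine ⟨hum.aestronglyMeasurable, ?_⟩
    rw [eLpNorm_lt_top_iff_lintegral_rpow_enorm_lt_top hp0 hp, ← setLIntegral_univ, ← hunion,
      lintegral_iUnion hmeas fun i j hij => Set.disjoint_iff_inter_eq_empty.2 (hdisj i j hij)]
    refine lt_of_le_of_lt (ENNReal.tsum_le_tsum (g := fun i => 2⁻¹ ^ i) fun i => ?_) ?_
    · have h1 := hc i
      rw [← eLpNorm_congr_ae (hres i), eLpNorm_eq_lintegral_rpow_enorm_toReal hp0 hp] at h1
      exact (ENNReal.rpow_le_rpow_iff (by positivity)).1 h1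
    · rw [ENNReal.tsum_geometric]
      simp
  refine ⟨hu.toLp u, c, fun i => ⟨hc0 i, Lp.ext ?_⟩⟩
  filter_upwards [coeFn_restrictL (Ωs i) (hu.toLp u), ae_restrict_of_ae hu.coeFn_toLp, hres i,
    Lp.coeFn_smul (c i) (g i)] with x h1 h2 h3 h4
  rw [h1, h2, h3, h4]

theorem exists_geometric (hmeas : ∀ i, MeasurableSet (Ωs i))
    (hdisj : ∀ i j, i ≠ j → Ωs i ∩ Ωs j = ∅) (hunion : ⋃ i, Ωs i = Set.univ)
    (U : Lp 𝕜 p μ) {t : 𝕜} (ht : ‖t‖ ≤ 1) :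
    ∃ V : Lp 𝕜 p μ, ∀ i, restrictL 𝕜 μ p (Ωs i) V = t ^ i • restrictL 𝕜 μ p (Ωs i) U := by
  obtain ⟨κ, hκ, hκi⟩ := exists_measurable_index hmeas hdisj hunion
  have hm : Measurable fun x => t ^ κ x := (measurable_from_nat (f := fun n => t ^ n)).comp hκ
  have hV : MemLp (fun x => t ^ κ x * U x) p μ := by
    refine (Lp.memLp U).mono (hm.aestronglyMeasurable.mul (Lp.aestronglyMeasurable U))
      (.of_forall fun x => ?_)
    rw [norm_mul, norm_pow]
    exact mul_le_of_le_one_left (norm_nonneg _) (pow_le_one₀ (norm_nonneg _) ht)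
  refine ⟨hV.toLp _, fun i => Lp.ext ?_⟩
  filter_upwards [coeFn_restrictL (Ωs i) (hV.toLp _), ae_restrict_of_ae hV.coeFn_toLp,
    Lp.coeFn_smul (t ^ i) (restrictL 𝕜 μ p (Ωs i) U), coeFn_restrictL (Ωs i) U,
    ae_restrict_mem (hmeas i)] with x h1 h2 h3 h4 h5
  rw [h1, h2, h3, Pi.smul_apply, h4, hκi i x h5, smul_eq_mul]

variable (Ωs) in
/-- The functions in `L_p` that are a multiple of `U` on each of the sets `Ωs i`. -/
noncomputable def piecewiseMultiples (U : Lp 𝕜 p μ) : Submodule 𝕜 (Lp 𝕜 p μ) :=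
  ⨅ i, (𝕜 ∙ restrictL 𝕜 μ p (Ωs i) U).comap (restrictL 𝕜 μ p (Ωs i))

theorem mem_piecewiseMultiples {U f : Lp 𝕜 p μ} : f ∈ piecewiseMultiples Ωs U ↔
    ∀ i, ∃ a : 𝕜, a • restrictL 𝕜 μ p (Ωs i) U = restrictL 𝕜 μ p (Ωs i) f := by
  simp [piecewiseMultiples, Submodule.mem_iInf, Submodule.mem_span_singleton]

theorem isClosed_piecewiseMultiples (hp : 0 < p) (U : Lp 𝕜 p μ) :
    IsClosed[lpTopology 𝕜 μ p] (piecewiseMultiples Ωs U : Set (Lp 𝕜 p μ)) := by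
  let _ : ∀ ν : Measure Ω, TopologicalSpace (Lp 𝕜 p ν) := fun ν => lpTopology 𝕜 ν p
  simp only [piecewiseMultiples, Submodule.coe_iInf, Submodule.comap_coe]
  exact isClosed_iInter fun i =>
    (isClosed_of_finiteDimensional hp _).preimage (continuous_restrictL (Ωs i))

/-- The coefficients on the pieces embed the space in ℕ → 𝕜, of cardinality at most 𝔠. Conversely,
it contains the functions with coefficients t ^ i, 0 < t < 1. -/
theorem rank_piecewiseMultiples (hmeas : ∀ i, MeasurableSet (Ωs i))
    (hdisj : ∀ i j, i ≠ j → Ωs i ∩ Ωs j = ∅) (hunion : ⋃ i, Ωs i = Set.univ)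
    {U : Lp 𝕜 p μ} (hU : ∀ i, restrictL 𝕜 μ p (Ωs i) U ≠ 0) :
    Module.rank 𝕜 (piecewiseMultiples Ωs U) = 𝔠 := by
  have hψ : ∀ i, ∃ ψ : Lp 𝕜 p (μ.restrict (Ωs i)) →ₗ[𝕜] 𝕜, ψ (restrictL 𝕜 μ p (Ωs i) U) = 1 :=
    fun i => Module.Projective.exists_dual_eq_one 𝕜 (hU i)
  choose ψ hψ using hψ
  let Φ : piecewiseMultiples Ωs U →ₗ[𝕜] (ℕ → 𝕜) :=
    LinearMap.pi fun i => ψ i ∘ₗ restrictL 𝕜 μ p (Ωs i) ∘ₗ Submodule.subtype _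
  have hΦ : ∀ f i, Φ f i = ψ i (restrictL 𝕜 μ p (Ωs i) f) := fun f i => rfl
  refine le_antisymm ?_ ?_
  · refine (rank_le_card 𝕜 _).trans ?_
    have hinj : Function.Injective Φ := by
      rw [← LinearMap.ker_eq_bot, LinearMap.ker_eq_bot']
      intro f hf
      refine Subtype.ext (eq_zero_of_restrictL hunion fun i => ?_)
      obtain ⟨a, ha⟩ := mem_piecewiseMultiples.1 f.2 i
      have h0 := hΦ f i
      rw [hf, ← ha, map_smul, hψ, smul_eq_mul, mul_one, Pi.zero_apply] at h0
      rw [← ha, ← h0, zero_smul]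
    have h1 := Cardinal.lift_mk_le_lift_mk_of_injective hinj
    have h2 := Cardinal.lift_le.2 (RCLike.mk_pi_nat_le_continuum 𝕜)
    have h3 := h1.trans h2
    rw [Cardinal.lift_continuum] at h3
    exact Cardinal.lift_le_continuum.1 h3
  · have hV : ∀ t : Set.Ioo (0 : ℝ) 1, ∃ V : Lp 𝕜 p μ, ∀ i,
        restrictL 𝕜 μ p (Ωs i) V = (t : 𝕜) ^ i • restrictL 𝕜 μ p (Ωs i) U := fun t =>
      exists_geometric hmeas hdisj hunion U (by
        rw [RCLike.norm_ofReal, abs_of_pos t.2.1]; exact t.2.2.le)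
    choose V hV using hV
    let V' : Set.Ioo (0 : ℝ) 1 → piecewiseMultiples Ωs U := fun t =>
      ⟨V t, mem_piecewiseMultiples.2 fun i => ⟨_, (hV t i).symm⟩⟩
    let m : Set.Ioo (0 : ℝ) 1 → (Multiplicative ℕ →* 𝕜) := fun t => powersHom 𝕜 (t : 𝕜)
    have hm : Function.Injective m := fun s t h => by
      have := (powersHom 𝕜).injective h
      exact Subtype.ext (RCLike.ofReal_injective this)
    -- Geometric sequences are distinct characters of the monoid ℕ, hence independent by Dedekind's
    -- theorem.
    have hlin : LinearIndependent 𝕜 (fun t => (fun n : ℕ => ((t : Set.Ioo (0 : ℝ) 1) : 𝕜) ^ n)) :=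
      (linearIndependent_monoidHom (Multiplicative ℕ) 𝕜).comp m hm
    have hlinV : LinearIndependent 𝕜 V' := by
      refine LinearIndependent.of_comp Φ ?_
      convert hlin using 1
      funext t i
      simp only [Function.comp_apply, hΦ, V', hV, map_smul, hψ, smul_eq_mul, mul_one]
    have h1 := hlinV.cardinal_lift_le_rank
    rw [Cardinal.mk_Ioo_real one_pos] at h1
    simpa using h1

theorem restrictL_mem_span_unionLq {Γ : Set ℝ≥0∞} {f : Lp 𝕜 p μ} (hf : f ∈ unionLq 𝕜 μ p Γ)
    (s : Set Ω) :
    restrictL 𝕜 μ p s f ∈ Submodule.span 𝕜 (unionLq 𝕜 (μ.restrict s) p Γ) := by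
  refine Submodule.subset_span ?_
  obtain ⟨q, hq, hfq⟩ := Set.mem_iUnion₂.1 hf
  have hfq : MemLp f q μ := hfq
  exact Set.mem_iUnion₂.2 ⟨q, hq, (hfq.restrict s).ae_eq (coeFn_restrictL s f).symm⟩

theorem exists_isClosed_extension (hp0 : 0 < p) (hp : p < ∞) {Γ : Set ℝ≥0∞}
    (hmeas : ∀ i, MeasurableSet (Ωs i))
    (hdisj : ∀ i j, i ≠ j → Ωs i ∩ Ωs j = ∅) (hunion : ⋃ i, Ωs i = Set.univ)
    (hlin : ∀ i, Lineability.IsLineable 𝕜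
      ((Submodule.span 𝕜 (unionLq 𝕜 (μ.restrict (Ωs i)) p Γ) :
        Set (Lp 𝕜 p (μ.restrict (Ωs i))))ᶜ))
    (F : Submodule 𝕜 (Lp 𝕜 p μ)) [FiniteDimensional 𝕜 F]
    (hF : (F : Set (Lp 𝕜 p μ)) ⊆ (unionLq 𝕜 μ p Γ)ᶜ ∪ {0}) :
    ∃ G : Submodule 𝕜 (Lp 𝕜 p μ), Module.rank 𝕜 G = 𝔠 ∧
      IsClosed[lpTopology 𝕜 μ p] (G : Set (Lp 𝕜 p μ)) ∧ F ≤ G ∧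
      (G : Set (Lp 𝕜 p μ)) ⊆ (unionLq 𝕜 μ p Γ)ᶜ ∪ {0} := by
  choose g hg using fun i => (hlin i).exists_notMem_sup (F.map (restrictL 𝕜 μ p (Ωs i)))
  obtain ⟨U, c, hU⟩ := exists_glue hp0.ne' hp.ne hmeas hdisj hunion g
  have hUi : ∀ i, restrictL 𝕜 μ p (Ωs i) U ∉ Submodule.span 𝕜
      (unionLq 𝕜 (μ.restrict (Ωs i)) p Γ) ⊔ F.map (restrictL 𝕜 μ p (Ωs i)) := fun i h => by
    rw [(hU i).2, Submodule.smul_mem_iff _ (hU i).1] at h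
    exact hg i h
  have hrank := rank_piecewiseMultiples hmeas hdisj hunion (U := U) fun i h =>
    hUi i (h ▸ Submodule.zero_mem _)
  refine ⟨piecewiseMultiples Ωs U ⊔ F, le_antisymm ?_ ?_, ?_, le_sup_right, ?_⟩
  · refine (Submodule.rank_add_le_rank_add_rank _ _).trans ?_
    rw [hrank]
    exact Cardinal.add_le_of_le Cardinal.aleph0_le_continuum le_rfl
      ((Module.rank_lt_aleph0 𝕜 F).trans Cardinal.aleph0_lt_continuum).le
  · rw [← hrank]
    exact Submodule.rank_mono le_sup_left
  · exact isClosed_sup_of_finiteDimensional _ F (isClosed_piecewiseMultiples hp0 U)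
  · intro w hw
    by_contra hcon
    have hw0 : w ∈ unionLq 𝕜 μ p Γ := by
      by_contra h
      exact hcon (Or.inl h)
    obtain ⟨h, hh, f, hf, rfl⟩ := Submodule.mem_sup.1 hw
    have h0 : h = 0 := eq_zero_of_restrictL hunion fun i => by
      obtain ⟨a, ha⟩ := mem_piecewiseMultiples.1 hh i
      rcases eq_or_ne a 0 with rfl | ha0
      · rw [← ha, zero_smul]
      -- Otherwise a • U = (h + f) - f on Ω_i would put U in the sum it avoids.
      · refine absurd ?_ (hUi i)
        rw [← Submodule.smul_mem_iff _ ha0, ha, ← add_sub_cancel_right h f, map_sub]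
        exact Submodule.sub_mem _
          (Submodule.mem_sup_left (restrictL_mem_span_unionLq hw0 _))
          (Submodule.mem_sup_right (Submodule.mem_map_of_mem hf))
    rw [h0, zero_add] at hcon
    exact hcon (hF hf)

end Sufficiency

end LebesgueSpace

theorem Submodule.exists_le_rank_eq {𝕜 E : Type*} [Field 𝕜] [AddCommGroup E] [Module 𝕜 E]
    (G : Submodule 𝕜 E) {α : Cardinal} (hα : α ≤ Module.rank 𝕜 G) :
    ∃ F ≤ G, Module.rank 𝕜 F = α := by
  obtain ⟨s, hs, hli⟩ := le_rank_iff_exists_linearIndependent.1 hα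
  refine ⟨(Submodule.span 𝕜 s).map G.subtype, Submodule.map_subtype_le _ _, ?_⟩
  rw [← hs, ← rank_span_set hli]
  exact ((Submodule.span 𝕜 s).equivMapOfInjective G.subtype G.subtype_injective).rank_eq.symm

theorem theoremt29 {𝕜 : Type*} [RCLike 𝕜] {Ω : Type*} [MeasurableSpace Ω] (μ : Measure Ω)
    (p : ℝ≥0∞) (hp0 : 0 < p) (hp : p < ∞)
    (Γ : Set ℝ≥0∞) (hΓ : Γ.Nonempty) (hΓp : Γ ⊆ Set.Ioc 0 ∞ \ {p})
    (Ωs : ℕ → Set Ω) (hmeas : ∀ i, MeasurableSet (Ωs i))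
    (hdisj : ∀ i j, i ≠ j → Ωs i ∩ Ωs j = ∅) (hunion : ⋃ i, Ωs i = Set.univ)
    (hlin : ∀ i, Lineability.IsLineable 𝕜
      ((Submodule.span 𝕜 (LebesgueSpace.unionLq 𝕜 (μ.restrict (Ωs i)) p Γ) :
        Set (Lp 𝕜 p (μ.restrict (Ωs i))))ᶜ))
    (α : Cardinal) :
    Lineability.IsSpaceable 𝕜 (LebesgueSpace.lpTopology 𝕜 μ p) α 𝔠
      ((LebesgueSpace.unionLq 𝕜 μ p Γ)ᶜ) ↔ α < ℵ₀ := by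
  refine ⟨LebesgueSpace.rank_lt_aleph0_of_isSpaceable hp0.ne' hp.ne hΓ, fun hα => ?_⟩
  have hα' := hα.trans Cardinal.aleph0_lt_continuum
  refine ⟨hα', ?_, fun F hF hFA => ?_⟩
  -- Extending the zero subspace gives dimension 𝔠, which leaves room for dimension α.
  · obtain ⟨G, hG, -, -, hGA⟩ := LebesgueSpace.exists_isClosed_extension hp0 hp hmeas hdisj hunion
      hlin ⊥ (fun f hf => Or.inr hf)
    obtain ⟨F, hFG, hF⟩ := G.exists_le_rank_eq (hG ▸ hα'.le)
    exact ⟨F, hF, fun f hf => (hGA (hFG hf.1)).resolve_right hf.2⟩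
  · have : FiniteDimensional 𝕜 F := Module.rank_lt_aleph0_iff.1 (hF ▸ hα)
    exact LebesgueSpace.exists_isClosed_extension hp0 hp hmeas hdisj hunion hlin F hFA
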